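/- Let $G$ be the graph with vertex set $\mathbb Z$ in which $m$ and $n$ are joined by an edge iff $m\neq n$ and $m\neq -n$, let $d$ be its shortest-path metric and $M=(\mathbb Z,d)$. Then $d(m,m)=0$, $d(m,-m)=2$ for $m\ne 0$, and $d(m,n)=1$ whenever $m\neq\pm n$; in particular $M$ is $1$-separated and $\operatorname{diam} M=2$. Let $\mathrm{Lip}_0(M)$ be the Banach space of real-valued Lipschitz functions on $M$ vanishing at $0$, normed by the least Lipschitz constant, and let $\mathcal F(M)=\overline{\operatorname{span}}\{\mathrm{ev}_x: x\in M\}\subset \mathrm{Lip}_0(M)^*$, where $\mathrm{ev}_x(f)=f(x)$, be the Lipschitz-free space over $M$. For a bounded sequence $(x_n)$ in a real Banach space $X$ put $$\operatorname{ca}(x_n)=\inf_{n}\operatorname{diam}\{x_k: k\ge n\},\qquad \widetilde{\operatorname{ca}}(x_n)=\inf\{\operatorname{ca}(x_{n_k}): (n_k)\text{ strictly increasing}\},$$ $$\delta(x_n)=\sup\{\operatorname{ca}(x^*(x_n)): x^*\in X^*,\ \|x^*\|\le 1\}.$$ The space $X$ has the $c$-Schur property if $\operatorname{ca}(x_n)\le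 c\,\delta(x_n)$ for every bounded sequence $(x_n)$ in $X$; it satisfies condition $(iii_c)$ if $\widetilde{\operatorname{ca}}(x_n)\le c\,\delta(x_n)$ for every bounded sequence $(x_n)$ in $X$. It has the $1$-strong Schur property if for all $\eta\in(0,2]$ and $\varepsilon>0$, every sequence $(x_n)$ in $X$ with $\|x_n\|=1$ for all $n$ and $\|x_n-x_m\|\ge\eta$ for all $n\ne m$ has a subsequence $(\frac2\eta+\varepsilon)$-equivalent to the standard basis of $\ell_1$. Here $(y_n)$ is $K$-equivalent to that basis if there are $a>0$ and $b\le Ka$ with $a\sum|t_n|\le\|\sum t_ny_n\|\le b\sum|t_n|$ for all finitely supported real $(t_n)$. Then: 1. $\mathcal F(M)$ has the $2$-Schur property, but it fails the $c$-Schur property for every real $c<2$. 2. $\mathcal F(M)$ satisfies condition $(iii_1)$. 3. $\mathcal F(M)$ has the $1$-strong Schur property. Consequently there is a real Banach space which has the $1$-strong Schur property but not the $1$-Schur property, so these two properties differ for real Banach spaces. -/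

import Mathlib

open scoped NNReal

noncomputable section

section LipschitzFree

variable (M : Type*) [MetricSpace M] (o : M)

/-- The vector space of real-valued Lipschitz functions on `M` vanishing at the point `o`. -/
def lipSubmodule : Submodule ℝ (M → ℝ) where
  carrier := {f | f o = 0 ∧ ∃ K : ℝ≥0, LipschitzWith K f}
  zero_mem' := ⟨rfl, 0, LipschitzWith.const 0⟩
  add_mem' := by
    rintro f g ⟨hf, K, hK⟩ ⟨hg, L, hL⟩
    exact ⟨by simp [hf, hg], K + L, hK.add hL⟩
  smul_mem' := by
    rintro c f ⟨hf, K, hK⟩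
    refine ⟨by simp [hf], ‖c‖₊ * K, LipschitzWith.of_dist_le_mul fun x y => ?_⟩
    have h := hK.dist_le_mul x y
    rw [Real.dist_eq] at h ⊢
    simp only [Pi.smul_apply, smul_eq_mul, ← mul_sub, abs_mul, NNReal.coe_mul, coe_nnnorm,
      Real.norm_eq_abs, mul_assoc]
    exact mul_le_mul_of_nonneg_left h (abs_nonneg c)

/-- `Lip₀(M)` with distinguished point `o`; its norm is the least Lipschitz constant. -/
def Lip0 : Type _ := ↥(lipSubmodule M o)

instance : AddCommGroup (Lip0 M o) := inferInstanceAs (AddCommGroup ↥(lipSubmodule M o))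
instance : Module ℝ (Lip0 M o) := inferInstanceAs (Module ℝ ↥(lipSubmodule M o))

variable {M o}

/-- The underlying function of an element of `Lip₀(M)`. -/
def Lip0.toFun (f : Lip0 M o) : M → ℝ := f.1

/-- The least Lipschitz constant. -/
instance : Norm (Lip0 M o) :=
  ⟨fun f => sInf {K : ℝ | 0 ≤ K ∧ ∀ x y, |f.toFun x - f.toFun y| ≤ K * dist x y}⟩

theorem Lip0.norm_def (f : Lip0 M o) :
    ‖f‖ = sInf {K : ℝ | 0 ≤ K ∧ ∀ x y, |f.toFun x - f.toFun y| ≤ K * dist x y} := rfl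

theorem Lip0.norm_le (f : Lip0 M o) {K : ℝ} (hK : 0 ≤ K)
    (h : ∀ x y, |f.toFun x - f.toFun y| ≤ K * dist x y) : ‖f‖ ≤ K :=
  csInf_le ⟨0, fun _ h => h.1⟩ ⟨hK, h⟩

theorem Lip0.norm_nonneg' (f : Lip0 M o) : 0 ≤ ‖f‖ :=
  Real.sInf_nonneg fun _ h => h.1

theorem Lip0.abs_sub_le (f : Lip0 M o) (x y : M) :
    |f.toFun x - f.toFun y| ≤ ‖f‖ * dist x y := by
  obtain ⟨-, K, hK⟩ := f.2
  have hne : {K : ℝ | 0 ≤ K ∧ ∀ x y, |f.toFun x - f.toFun y| ≤ K * dist x y}.Nonempty :=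
    ⟨K, K.2, fun x y => hK.dist_le_mul x y⟩
  rcases eq_or_lt_of_le (dist_nonneg (x := x) (y := y)) with h0 | hpos
  · have hxy : x = y := dist_eq_zero.1 h0.symm
    simp [hxy]
  · rw [← div_le_iff₀ hpos]
    exact le_csInf hne fun L hL => (div_le_iff₀ hpos).2 (hL.2 x y)

theorem Lip0.toFun_base (f : Lip0 M o) : f.toFun o = 0 := f.2.1

theorem Lip0.toFun_add (f g : Lip0 M o) (x : M) : (f + g).toFun x = f.toFun x + g.toFun x := rfl

theorem Lip0.toFun_smul (c : ℝ) (f : Lip0 M o) (x : M) : (c • f).toFun x = c * f.toFun x := rfl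

theorem Lip0.norm_smul_le' (c : ℝ) (f : Lip0 M o) : ‖c • f‖ ≤ ‖c‖ * ‖f‖ := by
  refine (c • f).norm_le (mul_nonneg (norm_nonneg c) f.norm_nonneg') fun x y => ?_
  rw [Lip0.toFun_smul, Lip0.toFun_smul, ← mul_sub, abs_mul, Real.norm_eq_abs, mul_assoc]
  exact mul_le_mul_of_nonneg_left (f.abs_sub_le x y) (abs_nonneg c)

theorem Lip0.normCore : NormedSpace.Core ℝ (Lip0 M o) where
  norm_nonneg := Lip0.norm_nonneg'
  norm_smul c f := by
    refine le_antisymm (Lip0.norm_smul_le' c f) ?_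
    rcases eq_or_ne c 0 with rfl | hc
    · simpa using Lip0.norm_nonneg' _
    · have h := Lip0.norm_smul_le' c⁻¹ (c • f)
      rw [smul_smul, inv_mul_cancel₀ hc, one_smul, norm_inv] at h
      rwa [inv_mul_eq_div, le_div_iff₀' (norm_pos_iff.2 hc)] at h
  norm_triangle f g := by
    refine (f + g).norm_le (add_nonneg f.norm_nonneg' g.norm_nonneg') fun x y => ?_
    rw [Lip0.toFun_add, Lip0.toFun_add, add_sub_add_comm, add_mul]
    exact (abs_add_le _ _).trans (add_le_add (f.abs_sub_le x y) (g.abs_sub_le x y))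
  norm_eq_zero_iff f := by
    constructor
    · intro h
      refine Subtype.ext (funext fun x => ?_)
      have hx := f.abs_sub_le x o
      rw [h, zero_mul, f.toFun_base, sub_zero] at hx
      exact abs_eq_zero.1 (le_antisymm hx (abs_nonneg _))
    · rintro rfl
      exact le_antisymm (Lip0.norm_le _ le_rfl fun x y => by
        change |(0 : ℝ) - 0| ≤ _
        simp) (Lip0.norm_nonneg' _)

instance : NormedAddCommGroup (Lip0 M o) := NormedAddCommGroup.ofCore Lip0.normCore
instance : NormedSpace ℝ (Lip0 M o) := NormedSpace.ofCore Lip0.normCore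

/-- The evaluation functional `f ↦ f x` on `Lip₀(M)`. -/
def lipEval (x : M) : StrongDual ℝ (Lip0 M o) :=
  LinearMap.mkContinuous
    { toFun := fun f => f.toFun x
      map_add' := fun f g => f.toFun_add g x
      map_smul' := fun c f => f.toFun_smul c x }
    (dist x o) (fun f => by
      have h := f.abs_sub_le x o
      rw [f.toFun_base, sub_zero, mul_comm] at h
      exact h)

variable (M o)

/-- The Lipschitz-free space: the closed linear span of the evaluation functionals in the dual
Banach space of `Lip₀(M)`. -/
def lipFree : Submodule ℝ (StrongDual ℝ (Lip0 M o)) :=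
  (Submodule.span ℝ (Set.range fun x : M => lipEval (o := o) x)).topologicalClosure

instance : CompleteSpace ↥(lipFree M o) :=
  Submodule.topologicalClosure.completeSpace _

end LipschitzFree

section Quantities

/-- The oscillation `inf_n diam {x_k : k ≥ n}` of a sequence. -/
def seqCa {α : Type*} [PseudoMetricSpace α] (x : ℕ → α) : ℝ :=
  ⨅ n : ℕ, Metric.diam (x '' Set.Ici n)

/-- The infimum of the oscillations of all subsequences. -/
def seqWca {α : Type*} [PseudoMetricSpace α] (x : ℕ → α) : ℝ :=
  ⨅ φ : {φ : ℕ → ℕ // StrictMono φ}, seqCa (x ∘ φ.1)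

variable (X : Type*) [NormedAddCommGroup X] [NormedSpace ℝ X]

variable {X} in
/-- The measure of weak non-Cauchyness: the supremum of the oscillations of `f (x_n)` over `f` in
the closed unit ball of the dual. -/
def seqDelta (x : ℕ → X) : ℝ :=
  ⨆ f : {f : StrongDual ℝ X // ‖f‖ ≤ 1}, seqCa fun n => f.1 (x n)

/-- The `c`-Schur property. -/
def HasSchur (c : ℝ) : Prop :=
  ∀ x : ℕ → X, Bornology.IsBounded (Set.range x) → seqCa x ≤ c * seqDelta x

/-- The subsequential variant of the `c`-Schur property (condition (iii) with constant `c`). -/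
def HasSubseqSchur (c : ℝ) : Prop :=
  ∀ x : ℕ → X, Bornology.IsBounded (Set.range x) → seqWca x ≤ c * seqDelta x

variable {X} in
/-- The sequence `x` is `K`-equivalent to the standard basis of `ℓ₁`: `e_n ↦ x_n` induces an
isomorphism `T` of `ℓ₁` onto the closed linear span of `x` with `‖T‖ * ‖T⁻¹‖ ≤ K`. -/
def IsEquivEllOneBasis (K : ℝ) (x : ℕ → X) : Prop :=
  ∃ a b : ℝ, 0 < a ∧ b ≤ K * a ∧ ∀ (s : Finset ℕ) (t : ℕ → ℝ),
    a * ∑ n ∈ s, |t n| ≤ ‖∑ n ∈ s, t n • x n‖ ∧ ‖∑ n ∈ s, t n • x n‖ ≤ b * ∑ n ∈ s, |t n|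

/-- The `1`-strong Schur property. -/
def HasOneStrongSchur : Prop :=
  ∀ d : ℝ, 0 < d → d ≤ 2 → ∀ ε : ℝ, 0 < ε → ∀ x : ℕ → X, (∀ n, ‖x n‖ = 1) →
    (∀ m n, m ≠ n → d ≤ ‖x m - x n‖) →
    ∃ φ : ℕ → ℕ, StrictMono φ ∧ IsEquivEllOneBasis (2 / d + ε) (x ∘ φ)

end Quantities

section Graph

/-- The graph on `ℤ` in which `m` and `n` are joined by an edge iff `m ≠ n` and `m ≠ -n`. -/
def signGraph : SimpleGraph ℤ where
  Adj m n := m ≠ n ∧ m ≠ -n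
  symm := ⟨fun _ _ h => ⟨h.1.symm, fun h' => h.2 (by omega)⟩⟩
  loopless := ⟨fun _ h => h.1 rfl⟩

theorem signGraph_connected : signGraph.Connected := by
  have h : ∀ n : ℤ, signGraph.Reachable 0 n := fun n => by
    rcases eq_or_ne n 0 with rfl | hn
    · exact SimpleGraph.Reachable.refl _
    · exact SimpleGraph.Adj.reachable (show (0 : ℤ) ≠ n ∧ (0 : ℤ) ≠ -n by omega)
  exact { preconnected := fun m n => (h m).symm.trans (h n) }

/-- The set `ℤ`, to be equipped with the shortest-path metric of `signGraph` instead of the usual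
metric of `ℤ`. -/
def SignSpace : Type := ℤ

/-- The identity map. -/
def SignSpace.of : ℤ ≃ SignSpace := Equiv.refl ℤ

instance : MetricSpace SignSpace where
  dist m n := (signGraph.dist (SignSpace.of.symm m) (SignSpace.of.symm n) : ℝ)
  dist_self m := by simp
  dist_comm m n := by rw [SimpleGraph.dist_comm]
  dist_triangle m n k := by exact_mod_cast signGraph_connected.dist_triangle
  eq_of_dist_eq_zero {m n} h := by
    have h' : signGraph.dist (SignSpace.of.symm m) (SignSpace.of.symm n) = 0 := by
      exact_mod_cast h
    exact SignSpace.of.symm.injective (signGraph_connected.dist_eq_zero_iff.1 h')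

end Graph

end

/-! The free space is a space of absolutely summable families `a` on `ℤ` (with `a 0 = 0`), the
evaluations being the unit vectors, and its norm is `max (‖a⁺‖₁, ‖a⁻‖₁, sup_n |a n - a (-n)|)`. The
substantial half is the upper bound, `tsum_lip_mul_le`: a function in the unit ball of `Lip₀` either
has oscillation at most `1`, or exceeds it on a single pair `±m`, and in both cases it is dominated
by a convex combination of the three quantities. The positive results use only this bound, the
estimate `‖a‖₁ ≤ 2‖x‖`, and the fact that a function with values in `[0,1]` acts as a functional of
norm at most `1`; `SignModel` records these facts.

A gliding hump (`exists_blockSplitting`) passes to a subsequence `x_k = b + z_k`, up to small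
errors, where the `z_k` live on disjoint sets symmetric under negation and `‖z_k⁺‖₁ ≈ p`, `‖z_k⁻‖₁ ≈
q`. A pair `±n` meets at most one block, so the third term of the norm gives at most `p + q`, as do
the first two; hence `‖x_k - x_l‖ ≲ p + q`. Selecting positive parts of even blocks and negative
parts of odd blocks gives a functional oscillating by about `p + q`, whence the subsequential
property with constant `1`. Signs on the blocks, of norm at most `2`, give the `ℓ₁` lower bound `(p
+ q)/2` and the strong Schur property. The constant `2` in the Schur property comes from `‖x‖ ≤
‖a⁺‖₁ + ‖a⁻‖₁`.

The constant `2` is optimal because of the sequence of evaluations at `1, -1, 2, -2, …`: consecutive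
opposite points stay at distance `2`, but a functional of norm at most `1` that separates one
opposite pair by more than `1` forces all other values into an interval shorter than `1`. -/

/-! ### The shortest-path metric -/

theorem signGraph_dist (m n : ℤ) :
    signGraph.dist m n = if m = n then 0 else if m = -n then 2 else 1 := by
  have adj_one : ∀ a b : ℤ, a ≠ b → a ≠ -b → signGraph.dist a b = 1 := fun a b h1 h2 =>
    SimpleGraph.dist_eq_one_iff_adj.2 ⟨h1, h2⟩
  split_ifs with h h'
  · simp [h]
  · have h0 : signGraph.dist m n ≠ 0 := fun h0 =>
      h (signGraph_connected.dist_eq_zero_iff.1 h0)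
    have h1 : signGraph.dist m n ≠ 1 := fun h1 => (SimpleGraph.dist_eq_one_iff_adj.1 h1).2 h'
    -- The vertex `0` is its own negative, so it is adjacent to every other vertex and gives a path
    -- of length two.
    have h2 := signGraph_connected.dist_triangle (u := m) (v := 0) (w := n)
    rw [adj_one m 0 (by omega) (by omega), adj_one 0 n (by omega) (by omega)] at h2
    omega
  · exact adj_one m n h h'

namespace SignSpace

theorem dist_of (m n : ℤ) :
    dist (of m) (of n) = if m = n then 0 else if m = -n then 2 else 1 := by
  change ((signGraph.dist m n : ℕ) : ℝ) = _
  rw [signGraph_dist]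
  split_ifs <;> simp

theorem dist_le_two (p q : SignSpace) : dist p q ≤ 2 := by
  obtain ⟨m, rfl⟩ := of.surjective p
  obtain ⟨n, rfl⟩ := of.surjective q
  rw [dist_of]
  split_ifs <;> norm_num

theorem one_le_dist {p q : SignSpace} (h : p ≠ q) : 1 ≤ dist p q := by
  obtain ⟨m, rfl⟩ := of.surjective p
  obtain ⟨n, rfl⟩ := of.surjective q
  rw [dist_of, if_neg fun e => h (congrArg of e)]
  split_ifs <;> norm_num

theorem diam_univ : Metric.diam (Set.univ : Set SignSpace) = 2 := by
  refine le_antisymm (Metric.diam_le_of_forall_dist_le zero_le_two fun p _ q _ => dist_le_two p q) ?_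
  have hb : Bornology.IsBounded (Set.univ : Set SignSpace) :=
    Metric.isBounded_iff.2 ⟨2, fun p _ q _ => dist_le_two p q⟩
  have h := Metric.dist_le_diam_of_mem hb (Set.mem_univ (of 1)) (Set.mem_univ (of (-1)))
  rw [dist_of] at h
  norm_num at h
  exact h

/-! ### Coordinates of functionals on `Lip₀` -/

/-- `Lip₀` of the sign space. -/
abbrev Lip : Type := Lip0 SignSpace (of 0)

/-- The Lipschitz-free space over the sign space. -/
abbrev Free : Type := ↥(lipFree SignSpace (of 0))

/-- A function on `ℤ` of oscillation at most `K`, as an element of `Lip₀`. -/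
def lipOf (g : ℤ → ℝ) (K : ℝ) (h0 : g 0 = 0) (h : ∀ m n, |g m - g n| ≤ K) : Lip :=
  ⟨fun p => g (of.symm p), h0, K.toNNReal, LipschitzWith.of_dist_le_mul fun p q => by
    have hK : 0 ≤ K := (abs_nonneg _).trans (h 0 0)
    rw [Real.coe_toNNReal _ hK]
    rcases eq_or_ne p q with rfl | hpq
    · simp
    · exact (h _ _).trans (le_mul_of_one_le_right hK (one_le_dist hpq))⟩

theorem lipOf_apply (g : ℤ → ℝ) (K : ℝ) (h0 : g 0 = 0) (h : ∀ m n, |g m - g n| ≤ K) (n : ℤ) :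
    (lipOf g K h0 h).toFun (of n) = g n := rfl

theorem norm_lipOf_le (g : ℤ → ℝ) (K : ℝ) (h0 : g 0 = 0) (h : ∀ m n, |g m - g n| ≤ K) :
    ‖lipOf g K h0 h‖ ≤ K := by
  have hK : 0 ≤ K := (abs_nonneg _).trans (h 0 0)
  refine Lip0.norm_le _ hK fun p q => ?_
  rcases eq_or_ne p q with rfl | hpq
  · simp
  · exact (h _ _).trans (le_mul_of_one_le_right hK (one_le_dist hpq))

theorem lip_ext {f g : Lip} (h : ∀ n, f.toFun (of n) = g.toFun (of n)) : f = g :=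
  Subtype.ext (funext fun p => h (of.symm p))

/-- The indicator function of `{j}`, replaced by `0` if `j = 0`. -/
def pointFn (j : ℤ) : Lip :=
  lipOf (fun n => if n = j ∧ n ≠ 0 then 1 else 0) 1 (by simp) fun m n => by
    split_ifs <;> norm_num

theorem pointFn_apply (j n : ℤ) :
    (pointFn j).toFun (of n) = if n = j ∧ n ≠ 0 then 1 else 0 := rfl

/-- The coordinates of a functional on `Lip₀` with respect to the evaluations. -/
noncomputable def coord : StrongDual ℝ Lip →ₗ[ℝ] ℤ → ℝ where
  toFun φ j := φ (pointFn j)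
  map_add' _ _ := rfl
  map_smul' _ _ := rfl

theorem coord_apply (φ : StrongDual ℝ Lip) (j : ℤ) : coord φ j = φ (pointFn j) := rfl

theorem coord_zero_right (φ : StrongDual ℝ Lip) : coord φ 0 = 0 := by
  have h : pointFn 0 = 0 := lip_ext fun n => by
    rw [pointFn_apply, if_neg (by tauto)]; rfl
  rw [coord_apply, h, map_zero]

theorem toFun_sum (s : Finset ℤ) (f : ℤ → Lip) (p : SignSpace) :
    (∑ j ∈ s, f j).toFun p = ∑ j ∈ s, (f j).toFun p := by
  classical
  induction s using Finset.induction_on with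
  | empty => rfl
  | insert j s hj ih => rw [Finset.sum_insert hj, Finset.sum_insert hj, Lip0.toFun_add, ih]

/-- Test against the function carrying the signs of the coordinates: it takes values in `[-1,1]` and
distinct points have distance at least `1`, so its Lipschitz constant is at most `2`. -/
theorem sum_abs_coord_le (φ : StrongDual ℝ Lip) (s : Finset ℤ) :
    ∑ j ∈ s, |coord φ j| ≤ 2 * ‖φ‖ := by
  classical
  let σ : ℤ → ℝ := fun j => if 0 ≤ coord φ j then 1 else -1
  have hσ : ∀ j, |σ j| ≤ 1 := fun j => by dsimp only [σ]; split_ifs <;> simp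
  let g : ℤ → ℝ := fun n => if n ∈ s ∧ n ≠ 0 then σ n else 0
  have hg : ∀ n, |g n| ≤ 1 := fun n => by dsimp only [g]; split_ifs <;> simp [hσ]
  have hosc : ∀ m n, |g m - g n| ≤ 2 := fun m n =>
    (abs_sub _ _).trans (by linarith [hg m, hg n])
  have hsum : ∑ j ∈ s, σ j • pointFn j = lipOf g 2 (by simp [g]) hosc := lip_ext fun n => by
    rw [toFun_sum, lipOf_apply]
    simp only [Lip0.toFun_smul, pointFn_apply, g]
    by_cases hn : n = 0
    · simp [hn]
    · simp [hn]
  have habs : ∀ j, |coord φ j| = σ j * coord φ j := fun j => by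
    dsimp only [σ]; split_ifs with h
    · rw [abs_of_nonneg h, one_mul]
    · rw [abs_of_neg (not_le.1 h), neg_one_mul]
  calc ∑ j ∈ s, |coord φ j| = φ (∑ j ∈ s, σ j • pointFn j) := by
        rw [map_sum]
        exact Finset.sum_congr rfl fun j _ => by rw [map_smul, smul_eq_mul, habs, coord_apply]
    _ ≤ ‖φ‖ * ‖lipOf g 2 (by simp [g]) hosc‖ := by
        rw [hsum]; exact (le_abs_self _).trans (φ.le_opNorm _)
    _ ≤ ‖φ‖ * 2 := mul_le_mul_of_nonneg_left (norm_lipOf_le _ _ _ _) (norm_nonneg _)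
    _ = 2 * ‖φ‖ := mul_comm _ _

theorem summable_coord (φ : StrongDual ℝ Lip) : Summable fun j => |coord φ j| :=
  summable_of_sum_le (fun _ => abs_nonneg _) (sum_abs_coord_le φ)

theorem tsum_abs_coord_le (φ : StrongDual ℝ Lip) : ∑' j, |coord φ j| ≤ 2 * ‖φ‖ :=
  (summable_coord φ).tsum_le_of_sum_le (sum_abs_coord_le φ)

end SignSpace

/-- A bounded multiple of an absolutely summable family is summable. -/
theorem Summable.bounded_mul {ι : Type*} {s a : ι → ℝ} {K : ℝ} (hs : ∀ j, |s j| ≤ K)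
    (ha : Summable fun j => |a j|) : Summable fun j => s j * a j :=
  Summable.of_norm_bounded (ha.mul_left K) fun j => by
    rw [Real.norm_eq_abs, abs_mul]
    exact mul_le_mul_of_nonneg_right (hs j) (abs_nonneg _)

theorem abs_tsum_mul_le {ι : Type*} {s a : ι → ℝ} {K : ℝ} (hs : ∀ j, |s j| ≤ K)
    (ha : Summable fun j => |a j|) : |∑' j, s j * a j| ≤ K * ∑' j, |a j| := by
  rw [← tsum_mul_left, ← Real.norm_eq_abs]
  exact tsum_of_norm_bounded (ha.mul_left K).hasSum fun j => by
    rw [Real.norm_eq_abs, abs_mul]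
    exact mul_le_mul_of_nonneg_right (hs j) (abs_nonneg _)

/-! ### The norm of the free space in coordinates -/

namespace SignSpace

theorem abs_toFun_le (f : Lip) (n : ℤ) : |f.toFun (of n)| ≤ ‖f‖ := by
  have h := f.abs_sub_le (of n) (of 0)
  rw [f.toFun_base, sub_zero] at h
  refine h.trans (mul_le_of_le_one_right (norm_nonneg f) ?_)
  rw [dist_of]
  split_ifs <;> simp_all

theorem toFun_base' (f : Lip) : f.toFun (of 0) = 0 := f.toFun_base

/-- Elements of the free space are determined by their coordinates. -/
theorem apply_eq_tsum (x : Free) (f : Lip) :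
    (x : StrongDual ℝ Lip) f = ∑' j, f.toFun (of j) * coord (x : StrongDual ℝ Lip) j := by
  have hf : ∀ j, |f.toFun (of j)| ≤ ‖f‖ := abs_toFun_le f
  let L : StrongDual ℝ Lip →L[ℝ] ℝ := LinearMap.mkContinuous
    { toFun := fun φ => φ f - ∑' j, f.toFun (of j) * coord φ j
      map_add' := fun φ ψ => by
        simp only [map_add, Pi.add_apply, mul_add, add_apply]
        rw [((summable_coord φ).bounded_mul hf).tsum_add ((summable_coord ψ).bounded_mul hf)]
        ring
      map_smul' := fun c φ => by
        simp only [map_smul, Pi.smul_apply, smul_eq_mul, smul_apply,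
          RingHom.id_apply, mul_left_comm _ c, tsum_mul_left]
        ring }
    -- The term `φ f` contributes `‖f‖` and the series `2 * ‖f‖`. Continuity then carries the
    -- identity from the evaluations to the closure of their span.
    (3 * ‖f‖) (fun φ => by
      have h1 := φ.le_opNorm f
      have h2 := abs_tsum_mul_le hf (summable_coord φ)
      have h3 := mul_le_mul_of_nonneg_left (tsum_abs_coord_le φ) (norm_nonneg f)
      rw [Real.norm_eq_abs] at h1 ⊢
      change |φ f - ∑' j, f.toFun (of j) * coord φ j| ≤ _
      refine (abs_sub _ _).trans ?_
      linarith)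
  have hL : ∀ φ, L φ = φ f - ∑' j, f.toFun (of j) * coord φ j := fun φ => rfl
  have hle : lipFree SignSpace (of 0) ≤ LinearMap.ker (L : StrongDual ℝ Lip →ₗ[ℝ] ℝ) := by
    refine Submodule.topologicalClosure_minimal _ (Submodule.span_le.2 ?_) L.isClosed_ker
    rintro _ ⟨p, rfl⟩
    obtain ⟨n, rfl⟩ := of.surjective p
    change L _ = 0
    rw [hL, tsum_eq_single n]
    · rw [coord_apply]
      change f.toFun (of n) - f.toFun (of n) * (pointFn n).toFun (of n) = 0
      rw [pointFn_apply]
      by_cases hn : n = 0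
      · subst hn; simp [toFun_base']
      · simp [hn]
    · intro j hj
      rw [coord_apply]
      change f.toFun (of j) * (pointFn j).toFun (of n) = 0
      rw [pointFn_apply, if_neg (fun h => hj h.1.symm), mul_zero]
  have h : L x = 0 := hle x.2
  rw [hL] at h
  exact sub_eq_zero.1 h

theorem summable_max_of_abs {ι : Type*} {a : ι → ℝ} (ha : Summable fun j => |a j|) :
    Summable fun j => max (a j) 0 :=
  Summable.of_nonneg_of_le (fun _ => le_max_right _ _)
    (fun _ => max_le (le_abs_self _) (abs_nonneg _)) ha

theorem summable_max_neg_of_abs {ι : Type*} {a : ι → ℝ} (ha : Summable fun j => |a j|) :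
    Summable fun j => max (-a j) 0 :=
  Summable.of_nonneg_of_le (fun _ => le_max_right _ _)
    (fun _ => max_le (neg_le_abs _) (abs_nonneg _)) ha

/-- The elementary inequality behind the formula for the norm of the free space. -/
theorem tsum_mul_le_of_weights {f a : ℤ → ℝ} {C α β γ : ℝ} (m : ℤ)
    (hf : ∀ j, |f j| ≤ 1) (ha : Summable fun j => |a j|)
    (hp : ∑' j, max (a j) 0 ≤ C) (hn : ∑' j, max (-a j) 0 ≤ C) (hd : a m - a (-m) ≤ C)
    (hα : 0 ≤ α) (hβ : 0 ≤ β) (hγ : 0 ≤ γ) (hsum : α + β + γ = 1)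
    (h : ∀ j, f j * a j ≤ α * max (a j) 0 + β * max (-a j) 0 +
      γ * ((if j = m then a m else 0) - if j = -m then a (-m) else 0)) :
    ∑' j, f j * a j ≤ C := by
  have h1 := ((summable_max_of_abs ha).hasSum.mul_left α).add
    ((summable_max_neg_of_abs ha).hasSum.mul_left β)
  have h2 := (((hasSum_ite_eq m (a m)).sub (hasSum_ite_eq (-m) (a (-m)))).mul_left γ)
  have h3 := hasSum_le h (ha.bounded_mul hf).hasSum (h1.add h2)
  have h4 := mul_le_mul_of_nonneg_left hp hα
  have h5 := mul_le_mul_of_nonneg_left hn hβ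
  have h6 := mul_le_mul_of_nonneg_left hd hγ
  have h7 : α * C + β * C + γ * C = C := by rw [← add_mul, ← add_mul, hsum, one_mul]
  linarith

/-- Values at non-opposite points differ by at most `1`. If some opposite pair differs by more, that
pair confines all remaining values; otherwise the whole range has length at most `1`. Each case
gives explicit convex weights for `tsum_mul_le_of_weights`. -/
theorem tsum_lip_mul_le {f : Lip} (hf : ‖f‖ ≤ 1) {a : ℤ → ℝ} {C : ℝ}
    (ha : Summable fun j => |a j|)
    (hp : ∑' j, max (a j) 0 ≤ C) (hn : ∑' j, max (-a j) 0 ≤ C)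
    (hd : ∀ n, |a n - a (-n)| ≤ C) :
    ∑' j, f.toFun (of j) * a j ≤ C := by
  set g : ℤ → ℝ := fun j => f.toFun (of j) with hg
  have hg0 : g 0 = 0 := toFun_base' f
  have hg1 : ∀ j, |g j| ≤ 1 := fun j => (abs_toFun_le f j).trans hf
  have hosc : ∀ m n, m ≠ -n → |g m - g n| ≤ 1 := fun m n hmn => by
    refine (f.abs_sub_le (of m) (of n)).trans ((mul_le_of_le_one_left dist_nonneg hf).trans ?_)
    rw [dist_of]; split_ifs <;> norm_num
  have hmul : ∀ {j : ℤ} {u v : ℝ}, g j ≤ u → -g j ≤ v →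
      g j * a j ≤ u * max (a j) 0 + v * max (-a j) 0 := fun {j u v} hu hv => by
    rcases le_total 0 (a j) with h | h
    · rw [max_eq_left h, max_eq_right (by linarith)]; nlinarith
    · rw [max_eq_right h, max_eq_left (by linarith)]; nlinarith
  by_cases hc : ∃ m, 1 < g m - g (-m)
  · obtain ⟨m, hm⟩ := hc
    have hm1 := abs_le.1 (hg1 m)
    have hm2 := abs_le.1 (hg1 (-m))
    -- Off `±m` the values of `g` lie in `[g m - 1, g (-m) + 1] = [-β, α]`, while `g m = α + γ` and
    -- `g (-m) = -(β + γ)`.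
    refine tsum_mul_le_of_weights (α := 1 + g (-m)) (β := 1 - g m) (γ := g m - g (-m) - 1) m hg1 ha
      hp hn ((le_abs_self _).trans (hd m)) (by linarith) (by linarith) (by linarith) (by ring)
      fun j => ?_
    have hm0 : m ≠ -m := fun h => by rw [← h] at hm; linarith
    by_cases h1 : j = m
    · subst h1
      rw [if_pos rfl, if_neg hm0]
      have e1 := le_max_left (a j) 0
      have e2 := le_max_right (-a j) 0
      nlinarith
    by_cases h2 : j = -m
    · subst h2
      rw [if_pos rfl, if_neg h1]
      have e1 := le_max_left (-a (-m)) 0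
      have e2 := le_max_right (a (-m)) 0
      nlinarith
    rw [if_neg h1, if_neg h2, sub_zero, mul_zero, add_zero]
    have e1 := abs_le.1 (hosc j (-m) (by rwa [neg_neg]))
    have e2 := abs_le.1 (hosc j m h2)
    exact hmul (by linarith) (by linarith)
  · have hall : ∀ m n, g m - g n ≤ 1 := fun m n => by
      by_cases h : m = -n
      · have := not_exists.1 hc m
        rw [h, neg_neg] at this
        rw [h]; linarith
      · exact (le_abs_self _).trans (hosc m n h)
    have hbdd : BddAbove (Set.range g) := ⟨1, by
      rintro _ ⟨j, rfl⟩; exact (abs_le.1 (hg1 j)).2⟩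
    have hα0 : 0 ≤ ⨆ j, g j := hg0 ▸ le_ciSup hbdd 0
    have hα1 : ⨆ j, g j ≤ 1 := ciSup_le fun j => (abs_le.1 (hg1 j)).2
    refine tsum_mul_le_of_weights (α := ⨆ j, g j) (β := 1 - ⨆ j, g j) (γ := 0) 0 hg1 ha
      hp hn ((le_abs_self _).trans (hd 0)) hα0 (by linarith) le_rfl (by ring) fun j => ?_
    rw [zero_mul, add_zero]
    have : ⨆ i, g i ≤ 1 + g j := ciSup_le fun i => by linarith [hall i j]
    exact hmul (le_ciSup hbdd j) (by linarith)


/-- A normed space of absolutely summable families on `ℤ` with the norm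
`max ‖a⁺‖₁ ‖a⁻‖₁ (sup_n |a_n - a_{-n}|)`. -/
structure _root_.SignModel (X : Type*) [NormedAddCommGroup X] [NormedSpace ℝ X] where
  /-- The coordinates of a vector. -/
  coord : X →ₗ[ℝ] ℤ → ℝ
  summable : ∀ x, Summable fun j => |coord x j|
  tsum_abs_le : ∀ x, ∑' j, |coord x j| ≤ 2 * ‖x‖
  norm_le : ∀ (x : X) (C : ℝ), ∑' j, max (coord x j) 0 ≤ C → ∑' j, max (-coord x j) 0 ≤ C →
    (∀ n, |coord x n - coord x (-n)| ≤ C) → ‖x‖ ≤ C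
  dual : ∀ s : ℤ → ℝ, (∀ j, s j ∈ Set.Icc (0 : ℝ) 1) →
    ∃ F : StrongDual ℝ X, ‖F‖ ≤ 1 ∧ ∀ x, F x = ∑' j, s j * coord x j

theorem abs_apply_lipOf_le (x : Free) (s : ℤ → ℝ) (K : ℝ) (h0 : s 0 = 0)
    (hs : ∀ m n, |s m - s n| ≤ K) :
    |(x : StrongDual ℝ Lip) (lipOf s K h0 hs)| ≤ K * ‖x‖ := by
  refine ((x : StrongDual ℝ Lip).le_opNorm _).trans ?_
  rw [mul_comm]
  exact mul_le_mul_of_nonneg_right (norm_lipOf_le _ _ _ _) (norm_nonneg _)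

theorem exists_dual_of_linear {X : Type*} [NormedAddCommGroup X] [NormedSpace ℝ X]
    (g : X →ₗ[ℝ] ℝ) {K : ℝ} (hK : 0 ≤ K) (h : ∀ x, |g x| ≤ K * ‖x‖) :
    ∃ F : StrongDual ℝ X, ‖F‖ ≤ K ∧ ∀ x, F x = g x :=
  ⟨g.mkContinuous K h, g.mkContinuous_norm_le hK h, fun _ => rfl⟩

theorem free_norm_le {x : Free} {C : ℝ}
    (hp : ∑' j, max (coord (x : StrongDual ℝ Lip) j) 0 ≤ C)
    (hn : ∑' j, max (-coord (x : StrongDual ℝ Lip) j) 0 ≤ C)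
    (hd : ∀ n, |coord (x : StrongDual ℝ Lip) n - coord (x : StrongDual ℝ Lip) (-n)| ≤ C) :
    ‖x‖ ≤ C := by
  have hC : 0 ≤ C := (abs_nonneg _).trans (hd 0)
  refine ContinuousLinearMap.opNorm_le_of_unit_norm (f := (x : StrongDual ℝ Lip)) hC fun f hf => ?_
  rw [Real.norm_eq_abs]
  refine abs_le.2 ⟨?_, ?_⟩
  · have h : (x : StrongDual ℝ Lip) (-f) ≤ C := by
      rw [apply_eq_tsum]
      exact tsum_lip_mul_le (by rw [norm_neg, hf]) (summable_coord _) hp hn hd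
    rw [map_neg] at h
    linarith
  · rw [apply_eq_tsum]
    exact tsum_lip_mul_le hf.le (summable_coord _) hp hn hd

/-- The free space over the sign space, in coordinates. -/
noncomputable def freeModel : SignModel Free where
  coord :=
    { toFun := fun x => coord (x : StrongDual ℝ Lip)
      map_add' := fun _ _ => rfl
      map_smul' := fun _ _ => rfl }
  summable x := summable_coord (x : StrongDual ℝ Lip)
  tsum_abs_le x := tsum_abs_coord_le (x : StrongDual ℝ Lip)
  norm_le _ _ hp hn hd := free_norm_le hp hn hd
  dual s hs := by
    -- Elements of `Lip₀` vanish at the base point. Resetting `s` to `0` there does not change the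
    -- pairing, since the coordinate at `0` is zero.
    have h : ∀ j, Function.update s 0 0 j ∈ Set.Icc (0 : ℝ) 1 := fun j => by
      by_cases hj : j = 0
      · simp [hj]
      · simpa [hj] using hs j
    have h0 : Function.update s 0 0 0 = 0 := by simp
    have hosc : ∀ m n, |Function.update s 0 0 m - Function.update s 0 0 n| ≤ 1 := fun m n =>
      abs_sub_le_iff.2 ⟨by linarith [(h m).2, (h n).1], by linarith [(h n).2, (h m).1]⟩
    obtain ⟨F, hF, hFx⟩ := exists_dual_of_linear (X := Free)
      { toFun := fun x => (x : StrongDual ℝ Lip) (lipOf _ 1 h0 hosc)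
        map_add' := fun _ _ => rfl
        map_smul' := fun _ _ => rfl } zero_le_one fun x => abs_apply_lipOf_le x _ 1 h0 hosc
    refine ⟨F, hF, fun x => (hFx x).trans ((apply_eq_tsum x _).trans (tsum_congr fun j => ?_))⟩
    rw [lipOf_apply]
    by_cases hj : j = 0
    · change _ * coord (x : StrongDual ℝ Lip) j = _ * coord (x : StrongDual ℝ Lip) j
      simp [hj, coord_zero_right]
    · rw [Function.update_of_ne hj]
      rfl

/-! ### Distances between evaluations -/

theorem lipschitzWith_opp (n : ℤ) : LipschitzWith 1 fun p : SignSpace =>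
    if of.symm p = n then (1 : ℝ) else if of.symm p = -n then -1 else 0 := by
  refine LipschitzWith.of_dist_le_mul fun p q => ?_
  obtain ⟨k, rfl⟩ := of.surjective p
  obtain ⟨l, rfl⟩ := of.surjective q
  rw [dist_of, Real.dist_eq, NNReal.coe_one, one_mul]
  simp only [Equiv.symm_apply_apply]
  by_cases hkl : k = l
  · simp [hkl]
  rw [if_neg hkl]
  split_ifs <;> first | omega | norm_num

/-- The function with value `1` at `n`, `-1` at `-n` and `0` elsewhere. -/
def oppFn {n : ℤ} (hn : n ≠ 0) : Lip :=
  ⟨fun p => if of.symm p = n then 1 else if of.symm p = -n then -1 else 0, by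
      simp [hn, hn.symm], 1, lipschitzWith_opp n⟩

theorem norm_oppFn_le {n : ℤ} (hn : n ≠ 0) : ‖oppFn hn‖ ≤ 1 := by
  refine Lip0.norm_le _ zero_le_one fun p q => ?_
  have h := (lipschitzWith_opp n).dist_le_mul p q
  rw [NNReal.coe_one, Real.dist_eq] at h
  exact h

/-- The evaluation at `n`, as an element of the free space. -/
noncomputable def evalAt (n : ℤ) : Free :=
  ⟨lipEval (of n), Submodule.le_topologicalClosure _ (Submodule.subset_span ⟨of n, rfl⟩)⟩

theorem coe_evalAt_sub (m n : ℤ) :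
    ((evalAt m - evalAt n : Free) : StrongDual ℝ Lip) = lipEval (of m) - lipEval (of n) := rfl

theorem norm_evalAt_sub_le (m n : ℤ) : ‖evalAt m - evalAt n‖ ≤ dist (of m) (of n) := by
  change ‖((evalAt m - evalAt n : Free) : StrongDual ℝ Lip)‖ ≤ _
  rw [coe_evalAt_sub]
  refine ContinuousLinearMap.opNorm_le_bound _ dist_nonneg fun f => ?_
  rw [mul_comm]
  exact f.abs_sub_le (of m) (of n)

theorem two_le_norm_evalAt_sub {n : ℤ} (hn : n ≠ 0) : 2 ≤ ‖evalAt n - evalAt (-n)‖ := by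
  change 2 ≤ ‖((evalAt n - evalAt (-n) : Free) : StrongDual ℝ Lip)‖
  rw [coe_evalAt_sub]
  have h := (lipEval (of n) - lipEval (of (-n)) : StrongDual ℝ Lip).le_opNorm (oppFn hn)
  have h1 : (lipEval (of n) - lipEval (of (-n)) : StrongDual ℝ Lip) (oppFn hn) =
      (if n = n then (1 : ℝ) else if n = -n then -1 else 0) -
        (if -n = n then (1 : ℝ) else if -n = -n then -1 else 0) := rfl
  rw [h1, if_pos rfl, if_neg (by omega), if_pos rfl] at h
  have h2 : ‖(1 : ℝ) - -1‖ = 2 := by norm_num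
  rw [h2] at h
  exact h.trans (mul_le_of_le_one_right (norm_nonneg _) (norm_oppFn_le hn))

end SignSpace

/-! ### The gliding hump -/

section BlockSplitting

open Filter Topology

/-- The family `a` is absolutely summable and has at most `ε` of its `ℓ₁`-norm outside `S`. -/
def ConcentratedOn (a : ℤ → ℝ) (S : Finset ℤ) (ε : ℝ) : Prop :=
  (Summable fun j => |a j|) ∧ ∑' j, |a j| ≤ ∑ j ∈ S, |a j| + ε

namespace ConcentratedOn

variable {a : ℤ → ℝ} {S : Finset ℤ} {ε : ℝ}

theorem abs_le_of_notMem (h : ConcentratedOn a S ε) {j : ℤ} (hj : j ∉ S) : |a j| ≤ ε := by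
  have h1 := h.1.sum_le_tsum (insert j S) fun _ _ => abs_nonneg _
  rw [Finset.sum_insert hj] at h1
  linarith [h.2]

theorem abs_tsum_mul_sub_le (h : ConcentratedOn a S ε) {s : ℤ → ℝ} (hs : ∀ j, |s j| ≤ 1) :
    |∑' j, s j * a j - ∑ j ∈ S, s j * a j| ≤ ε := by
  have h1 := (h.1.bounded_mul hs).sum_add_tsum_compl (s := S)
  have h2 := h.1.sum_add_tsum_compl (s := S)
  have h3 : |∑' j : ↑((S : Set ℤ)ᶜ), s j * a j| ≤ 1 * ∑' j : ↑((S : Set ℤ)ᶜ), |a j| :=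
    abs_tsum_mul_le (fun j => hs j) (h.1.subtype _)
  rw [← h1, add_sub_cancel_left]
  linarith [h.2]

theorem abs_tsum_mul_le_of_disjoint (h : ConcentratedOn a S ε) {s : ℤ → ℝ}
    (hs : ∀ j, |s j| ≤ 1) (h0 : ∀ j ∈ S, s j = 0) : |∑' j, s j * a j| ≤ ε := by
  have h1 := h.abs_tsum_mul_sub_le hs
  rwa [Finset.sum_eq_zero fun j hj => by rw [h0 j hj, zero_mul], sub_zero] at h1

end ConcentratedOn

/-- The integers `j` with `m < |j| ≤ n`. -/
noncomputable def annulus (m n : ℤ) : Finset ℤ := (Finset.Icc (-n) n).filter fun j => m < |j|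

theorem mem_annulus {m n j : ℤ} : j ∈ annulus m n ↔ m < |j| ∧ |j| ≤ n := by
  rw [annulus, Finset.mem_filter, Finset.mem_Icc, ← abs_le, and_comm]

theorem exists_tsum_le_sum_Icc_add {a : ℤ → ℝ} (ha : Summable fun j => |a j|) {ε : ℝ} (hε : 0 < ε)
    (N : ℤ) : ∃ N' > N, ConcentratedOn a (Finset.Icc (-N') N') ε := by
  obtain ⟨T, hT⟩ := (ha.hasSum.eventually (lt_mem_nhds (sub_lt_self _ hε))).exists
  obtain ⟨L, hL⟩ := (T.image fun j => |j|).bddAbove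
  refine ⟨max L (N + 1), by simp, ha, ?_⟩
  have hsub : T ⊆ Finset.Icc (-max L (N + 1)) (max L (N + 1)) := fun j hj =>
    Finset.mem_Icc.2 (abs_le.1 ((hL (Finset.mem_coe.2 (Finset.mem_image_of_mem _ hj))).trans
      (le_max_left _ _)))
  have := Finset.sum_le_sum_of_subset_of_nonneg hsub fun j _ _ => abs_nonneg (a j)
  linarith

/-- Coordinatewise convergence makes the mass on `[-N, N]` less than `ε / 2` for a late index, and
summability makes the mass beyond some `N'` at most `ε / 2`. -/
theorem exists_concentratedOn_annulus {z : ℕ → ℤ → ℝ} (hz : ∀ n, Summable fun j => |z n j|)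
    (h0 : ∀ j, Tendsto (fun n => z n j) atTop (𝓝 0)) {ε : ℝ} (hε : 0 < ε) (N : ℤ) (n₀ : ℕ) :
    ∃ n > n₀, ∃ N' > N, ConcentratedOn (z n) (annulus N N') ε := by
  have h1 : Tendsto (fun n => ∑ j ∈ Finset.Icc (-N) N, |z n j|) atTop (𝓝 0) := by
    have := tendsto_finsetSum (Finset.Icc (-N) N) fun j _ => (h0 j).abs
    simpa using this
  obtain ⟨n, hn, hn₀⟩ :=
    ((h1.eventually (gt_mem_nhds (half_pos hε))).and (eventually_gt_atTop n₀)).exists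
  obtain ⟨N', hN', hc⟩ := exists_tsum_le_sum_Icc_add (hz n) (half_pos hε) N
  refine ⟨n, hn₀, N', hN', hz n, ?_⟩
  have h2 := Finset.sum_filter_add_sum_filter_not (Finset.Icc (-N') N') (fun j => N < |j|)
    fun j => |z n j|
  have h3 : ∑ j ∈ (Finset.Icc (-N') N').filter (fun j => ¬ N < |j|), |z n j| ≤
      ∑ j ∈ Finset.Icc (-N) N, |z n j| := by
    refine Finset.sum_le_sum_of_subset_of_nonneg (fun j hj => ?_) fun _ _ _ => abs_nonneg _
    rw [Finset.mem_filter, not_lt] at hj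
    exact Finset.mem_Icc.2 (abs_le.1 hj.2)
  have h4 := hc.2
  rw [annulus]
  linarith

/-- The gliding hump construction: a coordinatewise null sequence of absolutely summable families
has a subsequence that is concentrated on disjoint annuli. -/
theorem exists_strictMono_concentratedOn {z : ℕ → ℤ → ℝ} (hz : ∀ n, Summable fun j => |z n j|)
    (h0 : ∀ j, Tendsto (fun n => z n j) atTop (𝓝 0)) {ε : ℝ} (hε : 0 < ε) (N₀ : ℤ) :
    ∃ φ : ℕ → ℕ, StrictMono φ ∧ ∃ N : ℕ → ℤ, StrictMono N ∧ N 0 = N₀ ∧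
      ∀ k, ConcentratedOn (z (φ k)) (annulus (N k) (N (k + 1))) ε := by
  choose g hg h hh hc using exists_concentratedOn_annulus hz h0 hε
  -- The state is the outer radius already used together with the last index chosen.
  let u : ℕ → ℤ × ℕ := fun k => Nat.rec (N₀, 0) (fun _ p => (h p.1 p.2, g p.1 p.2)) k
  have hu : ∀ k, u (k + 1) = (h (u k).1 (u k).2, g (u k).1 (u k).2) := fun k => rfl
  refine ⟨fun k => (u (k + 1)).2, strictMono_nat_of_lt_succ fun k => ?_, fun k => (u k).1,
    strictMono_nat_of_lt_succ fun k => ?_, rfl, fun k => ?_⟩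
  · rw [hu (k + 1)]; exact hg _ _
  · rw [hu]; exact hh _ _
  · dsimp only; rw [hu]; exact hc _ _

/-- A sequence of absolutely summable families on `ℤ` is, up to `ε`, the sum of a fixed family `b`
and a sequence of disjoint blocks whose positive and negative parts have `ℓ₁`-norms `p` and `q`. -/
structure BlockSplitting (a : ℕ → ℤ → ℝ) (ε : ℝ) where
  /-- The fixed part. -/
  b : ℤ → ℝ
  /-- The norm of the positive parts of the blocks. -/
  p : ℝ
  /-- The norm of the negative parts of the blocks. -/
  q : ℝ
  /-- The essential support of the fixed part. -/
  T : Finset ℤ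
  /-- The essential supports of the blocks. -/
  S : ℕ → Finset ℤ
  neg_mem : ∀ k, ∀ j ∈ S k, -j ∈ S k
  disjoint : ∀ j k l, j ∈ S k → j ∈ S l → k = l
  disjoint_fixed : ∀ j k, j ∈ S k → j ∉ T
  fixed : ConcentratedOn b T ε
  block : ∀ k, ConcentratedOn (a k - b) (S k) ε
  pos : ∀ k, |∑' j, max ((a k - b) j) 0 - p| ≤ ε
  neg : ∀ k, |∑' j, max (-(a k - b) j) 0 - q| ≤ ε

/-- The families lie in a product of compact intervals over a countable index set, which is
sequentially compact; the `ℓ₁` bound passes to the limit through finite partial sums. -/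
theorem exists_tendsto_subseq_of_tsum_le {a : ℕ → ℤ → ℝ} {B : ℝ}
    (ha : ∀ n, Summable fun j => |a n j|) (hB : ∀ n, ∑' j, |a n j| ≤ B) :
    ∃ b : ℤ → ℝ, (Summable fun j => |b j|) ∧ ∑' j, |b j| ≤ B ∧ ∃ φ : ℕ → ℕ, StrictMono φ ∧
      ∀ j, Tendsto (fun n => a (φ n) j) atTop (𝓝 (b j)) := by
  have hc : IsCompact (Set.univ.pi fun _ : ℤ => Set.Icc (-B) B) :=
    isCompact_univ_pi fun _ => isCompact_Icc
  obtain ⟨b, -, φ, hφ, hlim⟩ := hc.isSeqCompact (x := a) fun n j _ =>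
    abs_le.1 (((ha n).le_tsum j fun _ _ => abs_nonneg _).trans (hB n))
  rw [tendsto_pi_nhds] at hlim
  have hle : ∀ s : Finset ℤ, ∑ j ∈ s, |b j| ≤ B := fun s =>
    le_of_tendsto' (tendsto_finsetSum s fun j _ => (hlim j).abs) fun n =>
      ((ha _).sum_le_tsum s fun _ _ => abs_nonneg _).trans (hB _)
  have hs : Summable fun j => |b j| := summable_of_sum_le (fun _ => abs_nonneg _) hle
  exact ⟨b, hs, hs.tsum_le_of_sum_le hle, φ, hφ, hlim⟩

/-- Three extractions: a coordinatewise limit `b`, then limits `p` and `q` of the norms of the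
positive and negative parts of the differences, then a gliding hump for the differences, starting
outside the essential support of `b`. -/
theorem exists_blockSplitting {a : ℕ → ℤ → ℝ} {B : ℝ}
    (ha : ∀ n, Summable fun j => |a n j|) (hB : ∀ n, ∑' j, |a n j| ≤ B) {ε : ℝ} (hε : 0 < ε) :
    ∃ φ : ℕ → ℕ, StrictMono φ ∧ Nonempty (BlockSplitting (a ∘ φ) ε) := by
  obtain ⟨b, hb, hbB, φ, hφ, hlim⟩ := exists_tendsto_subseq_of_tsum_le ha hB
  have hz : ∀ n, Summable fun j => |(a n - b) j| := fun n =>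
    Summable.of_nonneg_of_le (fun _ => abs_nonneg _) (fun j => abs_sub (a n j) (b j))
      ((ha n).add hb)
  have hzB : ∀ n, ∑' j, |(a n - b) j| ≤ B + B := fun n =>
    ((hz n).tsum_le_tsum (fun j => abs_sub (a n j) (b j)) ((ha n).add hb)).trans
      (((ha n).tsum_add hb).trans_le (add_le_add (hB n) hbB))
  have hmem : ∀ n, (∑' j, max ((a (φ n) - b) j) 0, ∑' j, max (-(a (φ n) - b) j) 0) ∈
      Set.Icc (0 : ℝ) (B + B) ×ˢ Set.Icc (0 : ℝ) (B + B) := fun n =>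
    ⟨⟨tsum_nonneg fun _ => le_max_right _ _,
      ((SignSpace.summable_max_of_abs (hz _)).tsum_le_tsum
        (fun _ => max_le (le_abs_self _) (abs_nonneg _)) (hz _)).trans (hzB _)⟩,
      ⟨tsum_nonneg fun _ => le_max_right _ _,
      ((SignSpace.summable_max_neg_of_abs (hz _)).tsum_le_tsum
        (fun _ => max_le (neg_le_abs _) (abs_nonneg _)) (hz _)).trans (hzB _)⟩⟩
  obtain ⟨⟨p, q⟩, -, ψ, hψ, hpq⟩ := (isCompact_Icc.prod isCompact_Icc).isSeqCompact hmem
  rw [Prod.tendsto_iff] at hpq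
  -- Shifting the sequence by `K` makes the estimates for `p` and `q` hold at every index.
  obtain ⟨K, hK⟩ := eventually_atTop.1 ((hpq.1.eventually (Metric.ball_mem_nhds p hε)).and
    (hpq.2.eventually (Metric.ball_mem_nhds q hε)))
  obtain ⟨N₀, -, hN₀⟩ := exists_tsum_le_sum_Icc_add hb hε 0
  obtain ⟨χ, hχ, N, hN, hN0, hc⟩ := exists_strictMono_concentratedOn
    (z := fun n => a (φ (ψ (n + K))) - b) (fun n => hz _) (fun j => by
      have h1 : Tendsto (fun n => ψ (n + K)) atTop atTop :=
        hψ.tendsto_atTop.comp (tendsto_add_atTop_nat K)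
      have h2 := ((hlim j).comp h1).sub_const (b j)
      rwa [sub_self] at h2) hε N₀
  refine ⟨fun k => φ (ψ (χ k + K)), fun k l hkl => hφ (hψ (by have := hχ hkl; omega)),
    ⟨{ b := b, p := p, q := q, T := Finset.Icc (-N₀) N₀, S := fun k => annulus (N k) (N (k + 1)),
       neg_mem := ?_, disjoint := ?_, disjoint_fixed := ?_, fixed := hN₀, block := hc, pos := ?_,
       neg := ?_ }⟩⟩
  · intro k j hj
    rw [mem_annulus] at hj ⊢
    rwa [abs_neg]
  · intro j k l hk hl
    rw [mem_annulus] at hk hl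
    by_contra hne
    rcases lt_or_gt_of_ne hne with h | h
    · have := hN.monotone (Nat.succ_le_of_lt h)
      simp only [Nat.succ_eq_add_one] at this
      omega
    · have := hN.monotone (Nat.succ_le_of_lt h)
      simp only [Nat.succ_eq_add_one] at this
      omega
  · intro j k hk hj
    rw [mem_annulus] at hk
    have h1 := abs_le.2 (Finset.mem_Icc.1 hj)
    have h2 := hN.monotone (Nat.zero_le k)
    omega
  · exact fun k => (hK (χ k + K) (by omega)).1.le
  · exact fun k => (hK (χ k + K) (by omega)).2.le

end BlockSplitting

/-! ### Oscillation of sequences and of their images under functionals -/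

section Oscillation

variable {α : Type*} [PseudoMetricSpace α]

theorem isBounded_image_Ici {x : ℕ → α} (hx : Bornology.IsBounded (Set.range x)) (n : ℕ) :
    Bornology.IsBounded (x '' Set.Ici n) :=
  hx.subset (Set.image_subset_range _ _)

theorem seqCa_bddBelow (x : ℕ → α) :
    BddBelow (Set.range fun n : ℕ => Metric.diam (x '' Set.Ici n)) :=
  ⟨0, by rintro _ ⟨n, rfl⟩; exact Metric.diam_nonneg⟩

theorem seqCa_nonneg (x : ℕ → α) : 0 ≤ seqCa x := Real.iInf_nonneg fun _ => Metric.diam_nonneg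

theorem le_seqCa {x : ℕ → α} (hx : Bornology.IsBounded (Set.range x)) {r : ℝ}
    (h : ∀ N, ∃ m ≥ N, ∃ n ≥ N, r ≤ dist (x m) (x n)) : r ≤ seqCa x :=
  le_ciInf fun N => by
    obtain ⟨m, hm, n, hn, hr⟩ := h N
    exact hr.trans (Metric.dist_le_diam_of_mem (isBounded_image_Ici hx N)
      (Set.mem_image_of_mem x hm) (Set.mem_image_of_mem x hn))

theorem seqCa_le {x : ℕ → α} {r : ℝ} (hr : 0 ≤ r) (N : ℕ)
    (h : ∀ m ≥ N, ∀ n ≥ N, dist (x m) (x n) ≤ r) : seqCa x ≤ r :=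
  (ciInf_le (seqCa_bddBelow x) N).trans <| Metric.diam_le_of_forall_dist_le hr <| by
    rintro _ ⟨m, hm, rfl⟩ _ ⟨n, hn, rfl⟩
    exact h m hm n hn

theorem exists_lt_dist_of_lt_seqCa {x : ℕ → α} {r : ℝ} (hr : 0 ≤ r) (h : r < seqCa x) (N : ℕ) :
    ∃ m ≥ N, ∃ n ≥ N, r < dist (x m) (x n) := by
  by_contra! hcon
  exact h.not_ge (seqCa_le hr N hcon)

theorem seqWca_le_seqCa (x : ℕ → α) {φ : ℕ → ℕ} (hφ : StrictMono φ) :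
    seqWca x ≤ seqCa (x ∘ φ) :=
  ciInf_le (f := fun φ : {φ : ℕ → ℕ // StrictMono φ} => seqCa (x ∘ φ.1))
    ⟨0, by rintro _ ⟨ψ, rfl⟩; exact seqCa_nonneg _⟩ ⟨φ, hφ⟩

end Oscillation

section Dual

variable {X : Type*} [NormedAddCommGroup X] [NormedSpace ℝ X]

theorem isBounded_range_dual (F : StrongDual ℝ X) {x : ℕ → X}
    (hx : Bornology.IsBounded (Set.range x)) :
    Bornology.IsBounded (Set.range fun n => F (x n)) := by
  have h := F.lipschitz.isBounded_image hx
  rwa [← Set.range_comp] at h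

theorem seqCa_le_seqDelta {x : ℕ → X} (hx : Bornology.IsBounded (Set.range x))
    {F : StrongDual ℝ X} (hF : ‖F‖ ≤ 1) : seqCa (fun n => F (x n)) ≤ seqDelta x := by
  refine le_ciSup (f := fun F : {F : StrongDual ℝ X // ‖F‖ ≤ 1} => seqCa fun n => F.1 (x n))
    ⟨Metric.diam (Set.range x), ?_⟩ ⟨F, hF⟩
  rintro _ ⟨G, rfl⟩
  refine seqCa_le Metric.diam_nonneg 0 fun m _ n _ => ?_
  refine le_trans ?_ (Metric.dist_le_diam_of_mem hx (Set.mem_range_self m) (Set.mem_range_self n))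
  rw [Real.dist_eq, ← map_sub, dist_eq_norm, ← Real.norm_eq_abs]
  exact (G.1.le_opNorm _).trans (mul_le_of_le_one_left (norm_nonneg _) G.2)

theorem le_seqDelta {x : ℕ → X} (hx : Bornology.IsBounded (Set.range x))
    {F : StrongDual ℝ X} (hF : ‖F‖ ≤ 1) {r : ℝ}
    (h : ∀ N, ∃ m ≥ N, ∃ n ≥ N, r ≤ |F (x m) - F (x n)|) : r ≤ seqDelta x :=
  (le_seqCa (isBounded_range_dual F hx) h).trans (seqCa_le_seqDelta hx hF)

theorem seqDelta_nonneg (x : ℕ → X) : 0 ≤ seqDelta x :=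
  Real.iSup_nonneg fun _ => seqCa_nonneg _

end Dual

/-! ### Failure of the Schur property below the constant two -/

/-- The sequence `e 1, e (-1), e 2, e (-2), …` has oscillation at least `2`, while every functional
in the dual ball oscillates along its tails by at most `1`. -/
theorem not_hasSchur_of_opposite {X : Type*} [NormedAddCommGroup X] [NormedSpace ℝ X]
    (e : ℤ → X) (he : ∀ m n, ‖e m - e n‖ ≤ 2) (he1 : ∀ m n, m ≠ -n → ‖e m - e n‖ ≤ 1)
    (he2 : ∀ n ≠ 0, 2 ≤ ‖e n - e (-n)‖) {c : ℝ} (hc : c < 2) : ¬ HasSchur X c := by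
  intro hS
  let u : ℕ → ℤ := fun k => if Even k then (k / 2 : ℕ) + 1 else -((k / 2 : ℕ) + 1)
  have habs : ∀ k, |u k| = (k / 2 : ℕ) + 1 := fun k => by
    dsimp only [u]
    split_ifs
    · exact abs_of_nonneg (by omega)
    · rw [abs_neg]; exact abs_of_nonneg (by omega)
  have hbdd : Bornology.IsBounded (Set.range (e ∘ u)) := Metric.isBounded_iff.2 ⟨2, by
    rintro _ ⟨m, rfl⟩ _ ⟨n, rfl⟩
    rw [dist_eq_norm]
    exact he _ _⟩
  have hca : 2 ≤ seqCa (e ∘ u) := le_seqCa hbdd fun N => by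
    refine ⟨2 * N, by omega, 2 * N + 1, by omega, ?_⟩
    have h1 : u (2 * N) = N + 1 := by
      dsimp only [u]; rw [if_pos (even_two_mul N)]; omega
    have h2 : u (2 * N + 1) = -(N + 1) := by
      dsimp only [u]; rw [if_neg (by simp)]; omega
    rw [Function.comp_apply, Function.comp_apply, h1, h2, dist_eq_norm]
    exact he2 _ (by omega)
  have hdelta : seqDelta (e ∘ u) ≤ 1 := by
    have : Nonempty {F : StrongDual ℝ X // ‖F‖ ≤ 1} := ⟨⟨0, by simp⟩⟩
    refine ciSup_le fun F => ?_
    have hF : ∀ m n, m ≠ -n → |F.1 (e m) - F.1 (e n)| ≤ 1 := fun m n hmn => by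
      rw [← map_sub, ← Real.norm_eq_abs]
      exact (F.1.le_opNorm _).trans
        ((mul_le_of_le_one_left (norm_nonneg _) F.2).trans (he1 m n hmn))
    by_cases hex : ∃ m, 1 < F.1 (e m) - F.1 (e (-m))
    · obtain ⟨m, hm⟩ := hex
      -- From this index on `|u k| > |m|`, so every `F (e (u k))` lies within `1` of both `F (e m)`
      -- and `F (e (-m))`. These differ by more than `1`, which leaves an interval of length less
      -- than `1`.
      refine seqCa_le zero_le_one (2 * m.natAbs) fun k hk l hl => ?_
      have key : ∀ k ≥ 2 * m.natAbs, u k ≠ m ∧ u k ≠ -m := fun k hk => by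
        have h1 := habs k
        rw [Int.abs_eq_natAbs] at h1
        constructor <;> intro h2 <;> rw [h2] at h1 <;> omega
      have hk1 := abs_le.1 (hF (u k) m (key k hk).2)
      have hk2 := abs_le.1 (hF (u k) (-m) (by rw [neg_neg]; exact (key k hk).1))
      have hl1 := abs_le.1 (hF (u l) m (key l hl).2)
      have hl2 := abs_le.1 (hF (u l) (-m) (by rw [neg_neg]; exact (key l hl).1))
      rw [Real.dist_eq]
      exact abs_le.2 ⟨by dsimp only [Function.comp]; linarith,
        by dsimp only [Function.comp]; linarith⟩
    · have hall : ∀ m n, F.1 (e m) - F.1 (e n) ≤ 1 := fun m n => by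
        by_cases h : m = -n
        · have := not_exists.1 hex m
          rw [h, neg_neg] at this
          rw [h]; linarith
        · exact (le_abs_self _).trans (hF m n h)
      refine seqCa_le zero_le_one 0 fun k _ l _ => ?_
      rw [Real.dist_eq]
      exact abs_sub_le_iff.2 ⟨hall _ _, hall _ _⟩
  have h := hS _ hbdd
  rcases le_total 0 c with h0 | h0
  · linarith [mul_le_of_le_one_right h0 hdelta]
  · linarith [mul_nonpos_of_nonpos_of_nonneg h0 (seqDelta_nonneg (e ∘ u))]

/-! ### Splitting bounded sequences in the model -/

namespace SignModel

variable {X : Type*} [NormedAddCommGroup X] [NormedSpace ℝ X] (H : SignModel X)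

theorem tsum_mul_le (s : ℤ → ℝ) (hs : ∀ j, |s j| ≤ 1) (x : X) :
    ∑' j, s j * H.coord x j ≤ 2 * ‖x‖ := by
  have h := abs_tsum_mul_le hs (H.summable x)
  linarith [le_abs_self (∑' j, s j * H.coord x j), H.tsum_abs_le x]

theorem tsum_abs_eq {a : ℤ → ℝ} (ha : Summable fun j => |a j|) :
    ∑' j, |a j| = ∑' j, max (a j) 0 + ∑' j, max (-a j) 0 := by
  rw [← (SignSpace.summable_max_of_abs ha).tsum_add (SignSpace.summable_max_neg_of_abs ha)]
  refine tsum_congr fun j => ?_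
  rcases le_total 0 (a j) with h | h
  · rw [abs_of_nonneg h, max_eq_left h, max_eq_right (by linarith), add_zero]
  · rw [abs_of_nonpos h, max_eq_right h, max_eq_left (by linarith), zero_add]

theorem tsum_mul_sub {s a b : ℤ → ℝ} (hs : ∀ j, |s j| ≤ 1) (ha : Summable fun j => |a j|)
    (hb : Summable fun j => |b j|) :
    ∑' j, s j * (a - b) j = ∑' j, s j * a j - ∑' j, s j * b j := by
  rw [← (ha.bounded_mul hs).tsum_sub (hb.bounded_mul hs)]
  exact tsum_congr fun j => mul_sub _ _ _

theorem exists_splitting {x : ℕ → X} (hx : Bornology.IsBounded (Set.range x)) {ε : ℝ}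
    (hε : 0 < ε) : ∃ φ : ℕ → ℕ, StrictMono φ ∧
      Nonempty (BlockSplitting (fun k => H.coord (x (φ k))) ε) := by
  obtain ⟨B, hB⟩ := hx.exists_norm_le
  exact exists_blockSplitting (a := fun n => H.coord (x n)) (B := 2 * B)
    (fun n => H.summable _) (fun n => (H.tsum_abs_le _).trans
      (by linarith [hB _ (Set.mem_range_self n)])) hε

end SignModel

/-! ### Test functions selecting positive and negative parts -/

namespace BlockSplitting

variable {a : ℕ → ℤ → ℝ} {ε : ℝ} (P : BlockSplitting a ε)

/-- Select the positive part of the `k`-th block if `c k`, its negative part otherwise, and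
use `t` outside all blocks. -/
noncomputable def select (c : ℕ → Prop) (t : ℤ → Prop) (j : ℤ) : ℝ :=
  open Classical in
  if (∃ k, j ∈ P.S k ∧ ((c k ∧ 0 < (a k - P.b) j) ∨ (¬ c k ∧ (a k - P.b) j < 0))) ∨
    ((∀ k, j ∉ P.S k) ∧ t j) then 1 else 0

theorem select_mem_Icc (c : ℕ → Prop) (t : ℤ → Prop) (j : ℤ) :
    P.select c t j ∈ Set.Icc (0 : ℝ) 1 := by
  unfold select; split_ifs <;> simp

theorem abs_select_le (c : ℕ → Prop) (t : ℤ → Prop) (j : ℤ) : |P.select c t j| ≤ 1 := by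
  unfold select; split_ifs <;> simp

theorem select_mul_of_pos {c : ℕ → Prop} {k : ℕ} (hc : c k) (t : ℤ → Prop) {j : ℤ}
    (hj : j ∈ P.S k) : P.select c t j * (a k - P.b) j = max ((a k - P.b) j) 0 := by
  unfold select
  split_ifs with h
  · rcases h with ⟨l, hl, h⟩ | h
    · obtain rfl := P.disjoint j k l hj hl
      rw [one_mul, max_eq_left]
      exact (h.resolve_right fun h => h.1 hc).2.le
    · exact absurd hj (h.1 k)
  · rw [zero_mul, max_eq_right]
    exact not_lt.1 fun h' => h (Or.inl ⟨k, hj, Or.inl ⟨hc, h'⟩⟩)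

theorem select_mul_of_neg {c : ℕ → Prop} {k : ℕ} (hc : ¬ c k) (t : ℤ → Prop) {j : ℤ}
    (hj : j ∈ P.S k) : P.select c t j * (a k - P.b) j = -max (-(a k - P.b) j) 0 := by
  unfold select
  split_ifs with h
  · rcases h with ⟨l, hl, h⟩ | h
    · obtain rfl := P.disjoint j k l hj hl
      rw [one_mul, max_eq_left, neg_neg]
      exact neg_nonneg.2 (h.resolve_left fun h => hc h.1).2.le
    · exact absurd hj (h.1 k)
  · rw [zero_mul, max_eq_right, neg_zero]
    exact neg_nonpos.2 (not_lt.1 fun h' => h (Or.inl ⟨k, hj, Or.inr ⟨hc, h'⟩⟩))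

theorem pos_indicator_mul (r : ℝ) : (if 0 < r then (1 : ℝ) else 0) * r = max r 0 := by
  split_ifs with h
  · rw [one_mul, max_eq_left h.le]
  · rw [zero_mul, max_eq_right (not_lt.1 h)]

theorem neg_indicator_mul (r : ℝ) : (if r < 0 then (-1 : ℝ) else 0) * r = max (-r) 0 := by
  split_ifs with h
  · rw [neg_one_mul, max_eq_left (by linarith)]
  · rw [zero_mul, max_eq_right (by linarith)]

theorem abs_tsum_pos_sub_le {a : ℤ → ℝ} {S : Finset ℤ} {ε : ℝ} (h : ConcentratedOn a S ε) :
    |∑' j, max (a j) 0 - ∑ j ∈ S, max (a j) 0| ≤ ε := by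
  have := h.abs_tsum_mul_sub_le (s := fun j => if 0 < a j then 1 else 0) fun j => by
    split_ifs <;> simp
  simpa only [pos_indicator_mul] using this

theorem abs_tsum_neg_sub_le {a : ℤ → ℝ} {S : Finset ℤ} {ε : ℝ} (h : ConcentratedOn a S ε) :
    |∑' j, max (-a j) 0 - ∑ j ∈ S, max (-a j) 0| ≤ ε := by
  have := h.abs_tsum_mul_sub_le (s := fun j => if a j < 0 then -1 else 0) fun j => by
    split_ifs <;> simp
  simpa only [neg_indicator_mul] using this

/-- One `ε` pays for the mass of the block outside its essential support in the pairing, the other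
for the same mass in the positive part. -/
theorem tsum_select_of_pos {c : ℕ → Prop} {k : ℕ} (hc : c k) (t : ℤ → Prop) :
    |∑' j, P.select c t j * (a k - P.b) j - ∑' j, max ((a k - P.b) j) 0| ≤ 2 * ε := by
  have h1 := (P.block k).abs_tsum_mul_sub_le (P.abs_select_le c t)
  have h2 := abs_tsum_pos_sub_le (P.block k)
  rw [Finset.sum_congr rfl fun j hj => P.select_mul_of_pos hc t hj] at h1
  rw [abs_le] at h1 h2 ⊢
  constructor <;> linarith

theorem tsum_select_of_neg {c : ℕ → Prop} {k : ℕ} (hc : ¬ c k) (t : ℤ → Prop) :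
    |∑' j, P.select c t j * (a k - P.b) j + ∑' j, max (-(a k - P.b) j) 0| ≤ 2 * ε := by
  have h1 := (P.block k).abs_tsum_mul_sub_le (P.abs_select_le c t)
  have h2 := abs_tsum_neg_sub_le (P.block k)
  rw [Finset.sum_congr rfl fun j hj => P.select_mul_of_neg hc t hj, Finset.sum_neg_distrib] at h1
  rw [abs_le] at h1 h2 ⊢
  constructor <;> linarith

theorem tsum_select_fixed (c : ℕ → Prop) :
    |∑' j, P.select c (fun j => 0 < P.b j) j * P.b j - ∑' j, max (P.b j) 0| ≤ 2 * ε := by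
  have h1 := P.fixed.abs_tsum_mul_sub_le (P.abs_select_le c fun j => 0 < P.b j)
  have h2 := abs_tsum_pos_sub_le P.fixed
  have h3 : ∀ j ∈ P.T, P.select c (fun j => 0 < P.b j) j * P.b j = max (P.b j) 0 := fun j hj => by
    rw [← pos_indicator_mul, select]
    have hS : ∀ k, j ∉ P.S k := fun k hk => P.disjoint_fixed j k hk hj
    congr 1
    simp [hS]
  rw [Finset.sum_congr rfl h3] at h1
  rw [abs_le] at h1 h2 ⊢
  constructor <;> linarith

end BlockSplitting

/-! ### Differences of blocks and signs on blocks -/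

namespace BlockSplitting

variable {a : ℕ → ℤ → ℝ} {ε : ℝ} (P : BlockSplitting a ε)

theorem summable_block (k : ℕ) : Summable fun j => |(a k - P.b) j| := (P.block k).1

theorem abs_tsum_block_sub_le (k : ℕ) : |∑' j, |(a k - P.b) j| - (P.p + P.q)| ≤ 2 * ε := by
  rw [SignModel.tsum_abs_eq (P.summable_block k)]
  have h1 := abs_le.1 (P.pos k)
  have h2 := abs_le.1 (P.neg k)
  exact abs_le.2 ⟨by linarith, by linarith⟩

theorem nonneg (P : BlockSplitting a ε) : 0 ≤ ε := (abs_nonneg _).trans (P.pos 0)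

theorem sub_eq (k l : ℕ) (j : ℤ) : (a k - a l) j = (a k - P.b) j - (a l - P.b) j := by
  simp only [Pi.sub_apply]; ring

theorem max_sub_le (u v : ℝ) : max (u - v) 0 ≤ max u 0 + max (-v) 0 :=
  max_le (by linarith [le_max_left u 0, le_max_left (-v) 0])
    (add_nonneg (le_max_right _ _) (le_max_right _ _))

/-- The fixed part cancels, and the positive part of a difference of blocks is at most the positive
part of one plus the negative part of the other. -/
theorem tsum_pos_sub_le (k l : ℕ) : ∑' j, max ((a k - a l) j) 0 ≤ P.p + P.q + 4 * ε := by
  have hk := SignSpace.summable_max_of_abs (P.summable_block k)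
  have hl := SignSpace.summable_max_neg_of_abs (P.summable_block l)
  have h : ∑' j, max ((a k - a l) j) 0 ≤
      ∑' j, (max ((a k - P.b) j) 0 + max (-(a l - P.b) j) 0) := by
    refine Summable.tsum_le_tsum (fun j => ?_) ?_ (hk.add hl)
    · rw [P.sub_eq]; exact max_sub_le _ _
    · refine Summable.of_nonneg_of_le (fun _ => le_max_right _ _) (fun j => ?_) (hk.add hl)
      rw [P.sub_eq]; exact max_sub_le _ _
  rw [hk.tsum_add hl] at h
  have h1 := abs_le.1 (P.pos k)
  have h2 := abs_le.1 (P.neg l)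
  linarith [P.nonneg]

theorem abs_sub_neg_le_tsum {z : ℤ → ℝ} (hz : Summable fun j => |z j|) (n : ℤ) :
    |z n - z (-n)| ≤ ∑' j, |z j| := by
  by_cases hn : n = -n
  · rw [← hn, sub_self, abs_zero]
    exact tsum_nonneg fun _ => abs_nonneg _
  · have h := hz.sum_le_tsum {n, -n} fun _ _ => abs_nonneg _
    rw [Finset.sum_pair hn] at h
    exact (abs_sub _ _).trans h

/-- The essential supports are disjoint and symmetric, so `n` and `-n` lie together in at most one
of them. That block contributes at most its `ℓ₁`-norm, the other at most `2 * ε`. -/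
theorem abs_opposite_sub_le {k l : ℕ} (hkl : k ≠ l) (n : ℤ) :
    |(a k - a l) n - (a k - a l) (-n)| ≤ P.p + P.q + 4 * ε := by
  have key : ∀ i, n ∉ P.S i →
      |(a i - P.b) n - (a i - P.b) (-n)| ≤ 2 * ε := fun i hi => by
    have hi' : -n ∉ P.S i := fun h => hi (neg_neg n ▸ P.neg_mem i _ h)
    have h1 := (P.block i).abs_le_of_notMem hi
    have h2 := (P.block i).abs_le_of_notMem hi'
    exact (abs_sub _ _).trans (by linarith)
  have hall : ∀ i, |(a i - P.b) n - (a i - P.b) (-n)| ≤ P.p + P.q + 2 * ε := fun i =>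
    (abs_sub_neg_le_tsum (P.summable_block i) n).trans
      (by linarith [(abs_le.1 (P.abs_tsum_block_sub_le i)).2])
  have heq : (a k - a l) n - (a k - a l) (-n) =
      ((a k - P.b) n - (a k - P.b) (-n)) - ((a l - P.b) n - (a l - P.b) (-n)) := by
    rw [P.sub_eq, P.sub_eq]; ring
  rw [heq]
  refine (abs_sub _ _).trans ?_
  by_cases hn : n ∈ P.S k
  · have := key l fun h => hkl (P.disjoint n k l hn h)
    linarith [hall k]
  · linarith [key k hn, hall l]

open Classical in
/-- The signs of `t k • z k` on the `k`-th block, where `z k` is that block. -/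
noncomputable def signs (t : ℕ → ℝ) (j : ℤ) : ℝ :=
  if ∃ k, j ∈ P.S k ∧ 0 < t k * (a k - P.b) j then 1
  else if ∃ k, j ∈ P.S k ∧ t k * (a k - P.b) j < 0 then -1 else 0

theorem abs_signs_le (t : ℕ → ℝ) (j : ℤ) : |P.signs t j| ≤ 1 := by
  unfold signs; split_ifs <;> simp

theorem signs_fixed (t : ℕ → ℝ) {j : ℤ} (hj : j ∈ P.T) : P.signs t j = 0 := by
  have hS : ∀ k, j ∉ P.S k := fun k hk => P.disjoint_fixed j k hk hj
  simp [signs, hS]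

theorem signs_mul (t : ℕ → ℝ) {k : ℕ} {j : ℤ} (hj : j ∈ P.S k) :
    t k * (P.signs t j * (a k - P.b) j) = |t k| * |(a k - P.b) j| := by
  have hS : ∀ Q : ℕ → Prop, (∃ l, j ∈ P.S l ∧ Q l) ↔ Q k := fun Q =>
    ⟨fun ⟨l, hl, h⟩ => P.disjoint j k l hj hl ▸ h, fun h => ⟨k, hj, h⟩⟩
  rw [← abs_mul, signs, hS fun l => 0 < t l * (a l - P.b) j,
    hS fun l => t l * (a l - P.b) j < 0]
  split_ifs with h1 h2
  · rw [abs_of_pos h1, one_mul]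
  · rw [abs_of_neg h2]; ring
  · rw [le_antisymm (not_lt.1 h1) (not_lt.1 h2)]; simp

/-- The signs vanish on the essential support of `b`, so the fixed part costs only `ε`. Truncating
the block costs another `ε`, and its mass on the essential support is at least `p + q - 3 * ε`. -/
theorem le_mul_tsum_signs_mul (ha : ∀ k, Summable fun j => |a k j|) (t : ℕ → ℝ) (k : ℕ) :
    (P.p + P.q - 5 * ε) * |t k| ≤ t k * ∑' j, P.signs t j * a k j := by
  have hs := P.abs_signs_le t
  have hb := P.fixed.abs_tsum_mul_le_of_disjoint hs fun j hj => P.signs_fixed t hj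
  have hz := (P.block k).abs_tsum_mul_sub_le hs
  rw [SignModel.tsum_mul_sub hs (ha k) P.fixed.1] at hz
  have h1 : t k * ∑ j ∈ P.S k, P.signs t j * (a k - P.b) j =
      |t k| * ∑ j ∈ P.S k, |(a k - P.b) j| := by
    rw [Finset.mul_sum, Finset.mul_sum]
    exact Finset.sum_congr rfl fun j hj => P.signs_mul t hj
  have h2 := (P.block k).2
  have h3 := (abs_le.1 (P.abs_tsum_block_sub_le k)).1
  have h4 : |∑' j, P.signs t j * a k j - ∑ j ∈ P.S k, P.signs t j * (a k - P.b) j| ≤ 2 * ε := by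
    have e1 := abs_le.1 hb
    have e2 := abs_le.1 hz
    exact abs_le.2 ⟨by linarith, by linarith⟩
  have h5 : -(|t k| * (2 * ε)) ≤
      t k * (∑' j, P.signs t j * a k j - ∑ j ∈ P.S k, P.signs t j * (a k - P.b) j) := by
    refine (neg_le_neg ?_).trans (neg_abs_le _)
    rw [abs_mul]
    exact mul_le_mul_of_nonneg_left h4 (abs_nonneg _)
  have h6 : |t k| * (P.p + P.q - 3 * ε) ≤ |t k| * ∑ j ∈ P.S k, |(a k - P.b) j| :=
    mul_le_mul_of_nonneg_left (by linarith) (abs_nonneg _)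
  rw [mul_sub, h1] at h5
  linarith

end BlockSplitting

/-! ### The Schur-type properties of the model -/

namespace SignModel

variable {X : Type*} [NormedAddCommGroup X] [NormedSpace ℝ X] (H : SignModel X)

theorem norm_le_tsum (x : X) : ‖x‖ ≤ ∑' j, |H.coord x j| := by
  have hs := H.summable x
  have hp : 0 ≤ ∑' j, max (H.coord x j) 0 := tsum_nonneg fun _ => le_max_right _ _
  have hn : 0 ≤ ∑' j, max (-H.coord x j) 0 := tsum_nonneg fun _ => le_max_right _ _
  have h := tsum_abs_eq hs
  exact H.norm_le _ _ (by linarith) (by linarith) (BlockSplitting.abs_sub_neg_le_tsum hs)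

theorem norm_sub_le {x : ℕ → X} {ε : ℝ} (P : BlockSplitting (fun k => H.coord (x k)) ε)
    {k l : ℕ} (hkl : k ≠ l) : ‖x k - x l‖ ≤ P.p + P.q + 4 * ε := by
  refine H.norm_le _ _ ?_ ?_ ?_
  · rw [map_sub]; exact P.tsum_pos_sub_le k l
  · have h := P.tsum_pos_sub_le l k
    simpa only [map_sub, Pi.sub_apply, neg_sub] using h
  · rw [map_sub]; exact P.abs_opposite_sub_le hkl

/-- Along the split subsequence both the mutual distances and the oscillation of a suitable norm-one
functional are governed by the same number `p + q`. -/
theorem hasSubseqSchur (H : SignModel X) : HasSubseqSchur X 1 := by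
  intro x hx
  rw [one_mul]
  refine le_of_forall_pos_le_add fun η hη => ?_
  -- The upper bound for the oscillation loses four errors and the lower bound for `seqDelta` loses
  -- six.
  obtain ⟨φ, hφ, ⟨P⟩⟩ := H.exists_splitting hx (ε := η / 10) (by linarith)
  have h0 : 0 ≤ P.p + P.q + 4 * (η / 10) :=
    (norm_nonneg _).trans (H.norm_sub_le (x := x ∘ φ) P zero_ne_one)
  have h1 : seqCa (x ∘ φ) ≤ P.p + P.q + 4 * (η / 10) := by
    refine seqCa_le h0 0 fun k _ l _ => ?_
    rcases eq_or_ne k l with rfl | hkl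
    · rwa [dist_self]
    · rw [dist_eq_norm]
      exact H.norm_sub_le (x := x ∘ φ) P hkl
  -- Up to errors, `F` is `p` on even blocks and `-q` on odd ones; the contribution of the fixed
  -- part cancels in differences.
  obtain ⟨F, hF, hFx⟩ := H.dual (P.select Even fun _ => False) (P.select_mem_Icc _ _)
  have hs := P.abs_select_le Even fun _ => False
  have h2 : P.p + P.q - 6 * (η / 10) ≤ seqDelta x := by
    refine le_seqDelta hx hF fun N => ⟨φ (2 * N), ?_, φ (2 * N + 1), ?_, ?_⟩
    · have := hφ.le_apply (x := 2 * N)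
      omega
    · have := hφ.le_apply (x := 2 * N + 1)
      omega
    · have e1 := (abs_le.1 (P.tsum_select_of_pos (even_two_mul N) fun _ => False)).1
      have e2 := (abs_le.1 (P.tsum_select_of_neg (c := Even) (k := 2 * N + 1) (by simp)
        fun _ => False)).2
      rw [tsum_mul_sub hs (H.summable _) P.fixed.1, ← hFx] at e1 e2
      have e3 := (abs_le.1 (P.pos (2 * N))).1
      have e4 := (abs_le.1 (P.neg (2 * N + 1))).1
      refine le_trans ?_ (le_abs_self _)
      linarith
  linarith [seqWca_le_seqCa x hφ]

theorem exists_half_le_tsum_pos (x y : X) {r : ℝ} (h : r < ‖x - y‖) :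
    r / 2 ≤ ∑' j, max (H.coord (x - y) j) 0 ∨ r / 2 ≤ ∑' j, max (H.coord (y - x) j) 0 := by
  have h1 := H.norm_le_tsum (x - y)
  rw [tsum_abs_eq (H.summable _)] at h1
  have h2 : ∑' j, max (-H.coord (x - y) j) 0 = ∑' j, max (H.coord (y - x) j) 0 := by
    simp only [map_sub, Pi.sub_apply, neg_sub]
  rw [h2] at h1
  by_contra! hcon
  linarith

/-- Far-out differences of norm close to the oscillation have, after a possible swap, a positive
part of at least half that norm. Splitting these differences, rather than the sequence itself, gives
one functional that nearly attains all the positive parts along a subsequence: it selects the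
positive parts of the blocks and, off the blocks, of the fixed part. -/
theorem hasSchur_two (H : SignModel X) : HasSchur X 2 := by
  intro x hx
  by_contra! hlt
  have hδ := seqDelta_nonneg x
  obtain ⟨ε, hε⟩ : ∃ ε, seqCa x = 2 * seqDelta x + 20 * ε :=
    ⟨(seqCa x - 2 * seqDelta x) / 20, by ring⟩
  have hε0 : 0 < ε := by linarith
  have hex : ∀ N : ℕ, ∃ m n : ℕ, N ≤ m ∧ N ≤ n ∧
      seqDelta x + 9 * ε ≤ ∑' j, max (H.coord (x m - x n) j) 0 := fun N => by
    obtain ⟨m, hm, n, hn, h⟩ := exists_lt_dist_of_lt_seqCa (x := x)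
      (r := 2 * (seqDelta x + 9 * ε)) (by linarith) (by linarith) N
    rw [dist_eq_norm] at h
    rcases H.exists_half_le_tsum_pos _ _ h with h | h
    · exact ⟨m, n, hm, hn, by linarith⟩
    · exact ⟨n, m, hn, hm, by linarith⟩
  choose m n hm hn h using hex
  have hy : Bornology.IsBounded (Set.range fun k => x (m k) - x (n k)) := by
    refine (hx.sub hx).subset ?_
    rintro _ ⟨k, rfl⟩
    exact Set.sub_mem_sub (Set.mem_range_self _) (Set.mem_range_self _)
  obtain ⟨φ, hφ, ⟨P⟩⟩ := H.exists_splitting hy hε0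
  obtain ⟨F, hF, hFx⟩ := H.dual (P.select (fun _ => True) fun j => 0 < P.b j)
    (P.select_mem_Icc _ _)
  have hs := P.abs_select_le (fun _ => True) fun j => 0 < P.b j
  have hle : seqDelta x + 4 * ε ≤ seqDelta x := by
    refine le_seqDelta hx hF fun N => ⟨m (φ N), hφ.le_apply.trans (hm _), n (φ N),
      hφ.le_apply.trans (hn _), ?_⟩
    rw [← map_sub]
    refine le_trans ?_ (le_abs_self _)
    have e1 := (abs_le.1 (P.tsum_select_of_pos (c := fun _ => True) (k := N) trivial
      fun j => 0 < P.b j)).1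
    have e2 := (abs_le.1 (P.tsum_select_fixed fun _ => True)).1
    rw [tsum_mul_sub hs (H.summable _) P.fixed.1, ← hFx] at e1
    have hk := SignSpace.summable_max_of_abs (P.summable_block N)
    have hb := SignSpace.summable_max_of_abs P.fixed.1
    -- Subadditivity of the positive part: what is selected from the block and from `b` together
    -- dominates the positive part of the difference.
    have hadd : ∀ u v : ℝ, max u 0 ≤ max (u - v) 0 + max v 0 := fun u v =>
      max_le (by linarith [le_max_left (u - v) 0, le_max_left v 0])
        (add_nonneg (le_max_right _ _) (le_max_right _ _))
    have e3 := (SignSpace.summable_max_of_abs (H.summable (x (m (φ N)) - x (n (φ N))))).tsum_le_tsum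
      (fun j => hadd _ (P.b j)) (hk.add hb)
    have e5 := e3.trans_eq (hk.tsum_add hb)
    have e4 := h (φ N)
    linarith
  linarith

/-- Separation forces `p + q ≥ d - 4 * η`. Pairing a linear combination with the signs of its blocks
gives at least `(d - 9 * η) * ∑ |t n|`, and a sign function has norm at most `2` as a functional.
The upper estimate is the triangle inequality. -/
theorem hasOneStrongSchur (H : SignModel X) : HasOneStrongSchur X := by
  intro d hd _ ε hε x hx hsep
  have hbdd : Bornology.IsBounded (Set.range x) := isBounded_iff_forall_norm_le.2 ⟨1, by
    rintro _ ⟨n, rfl⟩; exact (hx n).le⟩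
  have hpos : 0 < 2 + ε * d := by positivity
  -- Solves `(2 / d + ε) * ((d - 9 * η) / 2) = 1`, so that the constants of equivalence match
  -- exactly.
  set η := ε * d ^ 2 / (9 * (2 + ε * d)) with hη
  have hη0 : 0 < η := by positivity
  have hη1 : 9 * η * (2 + ε * d) = ε * d ^ 2 := by rw [hη]; field_simp
  obtain ⟨φ, hφ, ⟨P⟩⟩ := H.exists_splitting hbdd hη0
  have hpq : d ≤ P.p + P.q + 4 * η :=
    (hsep _ _ (hφ.injective.ne zero_ne_one)).trans (H.norm_sub_le (x := x ∘ φ) P zero_ne_one)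
  refine ⟨φ, hφ, (d - 9 * η) / 2, 1, ?_, le_of_eq ?_, fun s t => ⟨?_, ?_⟩⟩
  · nlinarith
  · field_simp
    linarith
  · have hs := P.abs_signs_le t
    have h1 := H.tsum_mul_le (P.signs t) hs (∑ n ∈ s, t n • (x ∘ φ) n)
    have h2 : ∑' j, P.signs t j * H.coord (∑ n ∈ s, t n • (x ∘ φ) n) j =
        ∑ n ∈ s, t n * ∑' j, P.signs t j * H.coord (x (φ n)) j := by
      simp only [map_sum, map_smul, Finset.sum_apply, Pi.smul_apply, smul_eq_mul, Finset.mul_sum,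
        Function.comp_apply, mul_left_comm (P.signs t _)]
      rw [Summable.tsum_finsetSum fun n _ => ((H.summable _).bounded_mul hs).mul_left _]
      simp only [tsum_mul_left]
    have h3 : (d - 9 * η) * ∑ n ∈ s, |t n| ≤
        ∑ n ∈ s, t n * ∑' j, P.signs t j * H.coord (x (φ n)) j := by
      rw [Finset.mul_sum]
      refine Finset.sum_le_sum fun n _ => le_trans ?_
        (P.le_mul_tsum_signs_mul (fun k => H.summable _) t n)
      exact mul_le_mul_of_nonneg_right (by linarith) (abs_nonneg _)
    linarith
  · refine (norm_sum_le _ _).trans ?_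
    rw [one_mul]
    refine Finset.sum_le_sum fun n _ => ?_
    rw [norm_smul, Function.comp_apply, hx, mul_one, Real.norm_eq_abs]

end SignModel

theorem free_not_hasSchur {c : ℝ} (hc : c < 2) : ¬ HasSchur SignSpace.Free c :=
  not_hasSchur_of_opposite SignSpace.evalAt
    (fun m n => (SignSpace.norm_evalAt_sub_le m n).trans (SignSpace.dist_le_two _ _))
    (fun m n hmn => (SignSpace.norm_evalAt_sub_le m n).trans (by
      rw [SignSpace.dist_of, if_neg hmn]; split_ifs <;> norm_num))
    (fun n hn => SignSpace.two_le_norm_evalAt_sub hn) hc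

theorem mainTheorem8 :
    -- the metric space: shortest-path metric, its values, separation and diameter
    ((∀ m n : ℤ, dist (SignSpace.of m) (SignSpace.of n) = (signGraph.dist m n : ℝ)) ∧
      (∀ m n : ℤ, dist (SignSpace.of m) (SignSpace.of n) =
        if m = n then 0 else if m = -n then 2 else 1) ∧
      (∀ p q : SignSpace, p ≠ q → 1 ≤ dist p q) ∧
      Metric.diam (Set.univ : Set SignSpace) = 2) ∧
    -- its Lipschitz-free space, with distinguished point `0`
    HasSchur (lipFree SignSpace (SignSpace.of 0)) 2 ∧
    (∀ c : ℝ, c < 2 → ¬ HasSchur (lipFree SignSpace (SignSpace.of 0)) c) ∧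
    HasSubseqSchur (lipFree SignSpace (SignSpace.of 0)) 1 ∧
    HasOneStrongSchur (lipFree SignSpace (SignSpace.of 0)) ∧
    -- the 1-strong Schur and the 1-Schur property differ for real Banach spaces
    ∃ (X : Type) (_ : NormedAddCommGroup X) (_ : NormedSpace ℝ X),
      CompleteSpace X ∧ HasOneStrongSchur X ∧ ¬ HasSchur X 1 := by
  refine ⟨⟨fun _ _ => rfl, SignSpace.dist_of, fun _ _ => SignSpace.one_le_dist,
    SignSpace.diam_univ⟩, SignSpace.freeModel.hasSchur_two, fun _ => free_not_hasSchur,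
    SignSpace.freeModel.hasSubseqSchur, SignSpace.freeModel.hasOneStrongSchur,
    SignSpace.Free, inferInstance, inferInstance, inferInstance,
    SignSpace.freeModel.hasOneStrongSchur, free_not_hasSchur one_lt_two⟩
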